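/- Let $X$ be a real $3$-dimensional vector space equipped with a norm $\|\cdot\|$. For $p>0$, call a set $S\subseteq X$ $p$-equilateral if $\|x-y\|=p$ for all $x,y\in S$ with $x\neq y$, and call $S$ equilateral if it is $p$-equilateral for some $p>0$. If three distinct points $a,b,c\in X$ form a $p$-equilateral set, then there exists $d\in X$ such that $$\|d-a\|=\|d-b\|=\|d-c\|=p.$$ In other words, every equilateral set of $3$ elements in $X$ can be extended to an equilateral set of $4$ elements. -/

import Mathlib

/-- `S` is a `p`-equilateral set: `p > 0` and any two distinct points of `S` are at distance
`p` in the norm. -/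
def IsEquilateralWith {X : Type*} [NormedAddCommGroup X] (p : ℝ) (S : Set X) : Prop :=
  0 < p ∧ ∀ x ∈ S, ∀ y ∈ S, x ≠ y → ‖x - y‖ = p

/-- `S` is equilateral: it is `p`-equilateral for some `p > 0`. -/
def IsEquilateral {X : Type*} [NormedAddCommGroup X] (S : Set X) : Prop :=
  ∃ p : ℝ, IsEquilateralWith p S

/-!
For two points `a`, `b` with `dist a b < 2 * r`, the spheres of radius `r` about them meet exactly
in the shadow boundary of the lens `closedBall a r ∩ closedBall b r` lit in the direction `a - b`.
The shadow boundary of a convex body projects onto the boundary of the shadow, with convex fibers;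
in finite dimension at least three that boundary is a topological sphere of positive dimension,
hence connected, and so the shadow boundary is connected. In infinite dimension, any two points of
the intersection lie in a finite-dimensional subspace containing `a` and `b`.

If `c` lies on both spheres then so does its reflection `a + b - c`, whose distance from `c` is at
least `2 * r - dist a b`, so by connectedness the distance from `c` takes every value up to
`2 * r - dist a b` on the intersection. For an equilateral triple this range contains `r`.
-/

open Metric Set Module

section Topology

variable {α β : Type*} [TopologicalSpace α] [TopologicalSpace β]

theorem isPreconnected_of_isCompact_of_image_of_fibers [T2Space β] {s : Set α} {f : α → β}
    (hs : IsCompact s) (hf : ContinuousOn f s) (himage : IsPreconnected (f '' s))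
    (hfiber : ∀ y ∈ f '' s, IsPreconnected (s ∩ f ⁻¹' {y})) : IsPreconnected s := by
  rw [isPreconnected_closed_iff] at himage ⊢
  rintro t t' ht ht' hcover ⟨x, hx⟩ ⟨x', hx'⟩
  have isClosed_image {u : Set α} (hu : IsClosed u) : IsClosed (f '' (s ∩ u)) :=
    ((hs.inter_right hu).image_of_continuousOn (hf.mono inter_subset_left)).isClosed
  have hcover_image : f '' s ⊆ f '' (s ∩ t) ∪ f '' (s ∩ t') := by
    rw [← image_union, ← inter_union_distrib_left, inter_eq_self_of_subset_left hcover]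
  obtain ⟨_, hy, ⟨z, hz, rfl⟩, ⟨z', hz', hzz'⟩⟩ :=
    himage _ _ (isClosed_image ht) (isClosed_image ht') hcover_image
      ⟨f x, mem_image_of_mem f hx.1, mem_image_of_mem f hx⟩
      ⟨f x', mem_image_of_mem f hx'.1, mem_image_of_mem f hx'⟩
  obtain ⟨w, hw, hwt⟩ := isPreconnected_closed_iff.1 (hfiber _ hy) t t' ht ht'
    (inter_subset_left.trans hcover) ⟨z, ⟨hz.1, rfl⟩, hz.2⟩ ⟨z', ⟨hz'.1, hzz'⟩, hz'.2⟩
  exact ⟨w, hw.1, hwt⟩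

end Topology

section Dimension

variable {K V : Type*} [DivisionRing K] [AddCommGroup V] [Module K V]

theorem lt_rank_quotient_span_singleton {n : Cardinal} (hn : n + 1 < Module.rank K V) (u : V) :
    n < Module.rank K (V ⧸ K ∙ u) := by
  by_contra! hle
  have hspan : Module.rank K (K ∙ u) ≤ 1 := by simpa using rank_span_le (R := K) {u}
  exact hn.not_ge ((Submodule.rank_quotient_add_rank (K ∙ u)).symm.trans_le (add_le_add hle hspan))

theorem exists_finiteDimensional_superset_le_rank {n : ℕ} (hn : n ≤ Module.rank K V) {s : Set V}
    (hs : s.Finite) :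
    ∃ W : Submodule K V, FiniteDimensional K W ∧ s ⊆ W ∧ n ≤ Module.rank K W := by
  obtain ⟨t, ht, hindep⟩ := exists_finset_linearIndependent_of_le_rank hn
  refine ⟨Submodule.span K (s ∪ t), .span_of_finite K (hs.union t.finite_toSet),
    subset_union_left.trans Submodule.subset_span, ?_⟩
  calc (n : Cardinal) = Module.rank K (Submodule.span K (t : Set V)) := by
        rw [rank_span_set hindep, Finset.coe_sort_coe, Cardinal.mk_coe_finset, ht]
    _ ≤ Module.rank K (Submodule.span K (s ∪ t)) :=
        Submodule.rank_mono (Submodule.span_mono subset_union_right)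

end Dimension

section ShadowBoundary

theorem isConnected_frontier_of_convex_of_isBounded {Y : Type*} [NormedAddCommGroup Y]
    [NormedSpace ℝ Y] (hrank : 1 < Module.rank ℝ Y) {s : Set Y} (hconv : Convex ℝ s)
    (hne : (interior s).Nonempty) (hbdd : Bornology.IsBounded s) : IsConnected (frontier s) := by
  obtain ⟨h, -, -, hfrontier⟩ :=
    exists_homeomorph_image_interior_closure_frontier_eq_unitBall hconv hne hbdd
  rw [← h.isConnected_image, hfrontier]
  exact isConnected_sphere hrank 0 zero_le_one

/-- The shadow boundary of a body `K` under a projection `f`: the points of `K` at which the fibre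
of `f` (the light ray) does not enter the interior of `K`. -/
def shadowBoundary {X Y : Type*} [TopologicalSpace X] (f : X → Y) (K : Set X) : Set X :=
  K \ f ⁻¹' (f '' interior K)

variable {X Y : Type*} [AddCommGroup X] [Module ℝ X] [TopologicalSpace X] [AddCommGroup Y]
  [Module ℝ Y] {f : X →ₗ[ℝ] Y} {K : Set X}

theorem mem_shadowBoundary_mkQ_span_singleton {u x : X} :
    x ∈ shadowBoundary (ℝ ∙ u).mkQ K ↔ x ∈ K ∧ ∀ t : ℝ, x + t • u ∉ interior K := by
  have hray : x ∈ (ℝ ∙ u).mkQ ⁻¹' ((ℝ ∙ u).mkQ '' interior K) ↔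
      ∃ t : ℝ, x + t • u ∈ interior K := by
    constructor
    · rintro ⟨z, hz, hzx⟩
      obtain ⟨t, ht⟩ := Submodule.mem_span_singleton.1 ((Submodule.Quotient.eq _).1 hzx)
      exact ⟨t, by rwa [ht, add_sub_cancel]⟩
    · rintro ⟨t, ht⟩
      refine ⟨_, ht, (Submodule.Quotient.eq _).2 (Submodule.mem_span_singleton.2 ⟨t, ?_⟩)⟩
      rw [add_sub_cancel_left]
  rw [shadowBoundary, mem_sdiff, hray, not_exists]

theorem convex_shadowBoundary_inter_fiber (hconv : Convex ℝ K) {y : Y}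
    (hy : y ∈ f '' shadowBoundary f K) : Convex ℝ (shadowBoundary f K ∩ f ⁻¹' {y}) := by
  obtain ⟨x, hx, rfl⟩ := hy
  have hfiber : shadowBoundary f K ∩ f ⁻¹' {f x} = K ∩ f ⁻¹' {f x} := by
    ext z
    refine ⟨fun hz => ⟨hz.1.1, hz.2⟩, fun hz => ⟨⟨hz.1, ?_⟩, hz.2⟩⟩
    rw [mem_preimage, show f z = f x from hz.2]
    exact hx.2
  rw [hfiber]
  exact hconv.inter ((convex_singleton _).linear_preimage f)

variable [IsTopologicalAddGroup X] [ContinuousSMul ℝ X]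

theorem image_shadowBoundary [TopologicalSpace Y] [T2Space Y] (hf : IsOpenQuotientMap f)
    (hK : IsCompact K) (hconv : Convex ℝ K) (hne : (interior K).Nonempty) :
    f '' shadowBoundary f K = frontier (f '' interior K) := by
  have hclosure : closure (f '' interior K) = f '' K := by
    refine (closure_minimal (image_mono interior_subset)
      (hK.image hf.continuous).isClosed).antisymm ?_
    calc f '' K ⊆ f '' closure (interior K) := by
          rw [hconv.closure_interior_eq_closure_of_nonempty_interior hne]
          exact image_mono subset_closure
      _ ⊆ closure (f '' interior K) := image_closure_subset_closure_image hf.continuous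
  rw [shadowBoundary, image_sdiff_preimage, (hf.isOpenMap _ isOpen_interior).frontier_eq, hclosure]

theorem isPreconnected_shadowBoundary {Y : Type*} [NormedAddCommGroup Y] [NormedSpace ℝ Y]
    (hrank : 1 < Module.rank ℝ Y) {f : X →ₗ[ℝ] Y} (hf : IsOpenQuotientMap f) (hK : IsCompact K)
    (hconv : Convex ℝ K) (hne : (interior K).Nonempty) :
    IsPreconnected (shadowBoundary f K) := by
  have hopen : IsOpen (f '' interior K) := hf.isOpenMap _ isOpen_interior
  have hcompact : IsCompact (shadowBoundary f K) := hK.diff (hopen.preimage hf.continuous)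
  refine isPreconnected_of_isCompact_of_image_of_fibers hcompact hf.continuous.continuousOn ?_
    fun y hy => (convex_shadowBoundary_inter_fiber hconv hy).isPreconnected
  rw [image_shadowBoundary hf hK hconv hne]
  refine (isConnected_frontier_of_convex_of_isBounded hrank
    (hconv.interior.linear_image f) ?_ ?_).isPreconnected
  · rw [hopen.interior_eq]
    exact hne.image f
  · exact (hK.image hf.continuous).isBounded.subset (image_mono interior_subset)

end ShadowBoundary

section SphereInterSphere

theorem lt_of_convexOn_of_mem_openSegment {E : Type*} [AddCommGroup E] [Module ℝ E] {s : Set E}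
    {g : E → ℝ} (hg : ConvexOn ℝ s g) {r : ℝ} {x y z : E} (hx : x ∈ s) (hy : y ∈ s)
    (hgx : g x < r) (hgy : g y ≤ r) (hz : z ∈ openSegment ℝ x y) : g z < r := by
  by_contra! hle
  exact (hg.lt_right_of_left_lt hx hy hz (hgx.trans_le hle)).not_ge (hgy.trans hle)

theorem forall_le_max_iff_of_convexOn {g : ℝ → ℝ} (hg : ConvexOn ℝ univ g) {r : ℝ} (h₀ : g 0 ≤ r)
    (h₁ : g 1 ≤ r) : (∀ t, r ≤ max (g t) (g (t + 1))) ↔ g 0 = r ∧ g 1 = r := by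
  have lt_of_mem {s t z : ℝ} (hs : g s < r) (ht : g t ≤ r) (hz : z ∈ openSegment ℝ s t) : g z < r :=
    lt_of_convexOn_of_mem_openSegment hg (mem_univ s) (mem_univ t) hs ht hz
  have hcont : Continuous g := continuousOn_univ.1 (hg.continuousOn isOpen_univ)
  constructor
  · refine fun h => ⟨h₀.eq_of_not_lt fun hlt => ?_, h₁.eq_of_not_lt fun hlt => ?_⟩
    · have hnear : ∀ᶠ t in nhdsWithin (0 : ℝ) (Iio 0), g t < r :=
        (hcont.continuousAt.eventually_lt_const hlt).filter_mono nhdsWithin_le_nhds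
      obtain ⟨t, ht, ht₁, ht₀⟩ :=
        (hnear.and (Ioo_mem_nhdsLT (neg_one_lt_zero (R := ℝ)))).exists
      refine (h t).not_gt (max_lt ht (lt_of_mem hlt h₁ ?_))
      rw [openSegment_eq_Ioo zero_lt_one]
      constructor <;> linarith
    · have hnear : ∀ᶠ t in nhdsWithin (0 : ℝ) (Ioi 0), g (t + 1) < r :=
        ((hcont.comp (continuous_add_const 1)).continuousAt.eventually_lt_const
          (by simpa using hlt)).filter_mono nhdsWithin_le_nhds
      obtain ⟨t, ht, ht₀, ht₁⟩ := (hnear.and (Ioo_mem_nhdsGT (zero_lt_one (α := ℝ)))).exists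
      refine (h t).not_gt (max_lt (lt_of_mem hlt h₀ ?_) ht)
      rw [openSegment_symm, openSegment_eq_Ioo zero_lt_one]
      exact ⟨ht₀, ht₁⟩
  · rintro ⟨e₀, e₁⟩ t
    by_contra! hlt
    obtain ⟨ht, ht'⟩ := max_lt_iff.1 hlt
    rcases lt_trichotomy t 0 with hneg | rfl | hpos
    · refine (lt_of_mem ht h₁ ?_).ne e₀
      rw [openSegment_eq_Ioo (by linarith)]
      exact ⟨hneg, zero_lt_one⟩
    · exact ht.ne e₀
    · refine (lt_of_mem ht' h₀ ?_).ne e₁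
      rw [openSegment_symm, openSegment_eq_Ioo (by linarith)]
      constructor <;> linarith

variable {X : Type*} [NormedAddCommGroup X] [NormedSpace ℝ X] {a b : X} {r : ℝ}

theorem interior_closedBall_inter_closedBall (hr : r ≠ 0) :
    interior (closedBall a r ∩ closedBall b r) = ball a r ∩ ball b r := by
  rw [interior_inter, interior_closedBall a hr, interior_closedBall b hr]

theorem shadowBoundary_closedBall_inter_closedBall (hr : r ≠ 0) :
    shadowBoundary (ℝ ∙ (a - b)).mkQ (closedBall a r ∩ closedBall b r) =
      sphere a r ∩ sphere b r := by
  ext x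
  let g : ℝ → ℝ := fun t => dist (x + t • (a - b)) a
  have hg : ConvexOn ℝ univ g :=
    ((convexOn_univ_dist a).translate_right x).comp_linearMap
      (LinearMap.toSpanSingleton ℝ X (a - b))
  have dist_a : dist x a = g 0 := by simp [g]
  have dist_b (t : ℝ) : dist (x + t • (a - b)) b = g (t + 1) := by
    simp only [g, dist_eq_norm]
    congr 1
    module
  have dist_b_zero : dist x b = g 1 := by simpa using dist_b 0
  have hexits (t : ℝ) : x + t • (a - b) ∉ ball a r ∩ ball b r ↔ r ≤ max (g t) (g (t + 1)) := by
    rw [mem_inter_iff, mem_ball, mem_ball, dist_b, ← max_lt_iff, not_lt]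
  rw [mem_shadowBoundary_mkQ_span_singleton, interior_closedBall_inter_closedBall hr,
    forall_congr' hexits]
  simp only [mem_inter_iff, mem_closedBall, mem_sphere, dist_a, dist_b_zero]
  constructor
  · rintro ⟨⟨h₀, h₁⟩, hmax⟩
    exact (forall_le_max_iff_of_convexOn hg h₀ h₁).1 hmax
  · rintro ⟨h₀, h₁⟩
    exact ⟨⟨h₀.le, h₁.le⟩, (forall_le_max_iff_of_convexOn hg h₀.le h₁.le).2 ⟨h₀, h₁⟩⟩

theorem midpoint_mem_ball_inter_ball (h : dist a b < 2 * r) :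
    midpoint ℝ a b ∈ ball a r ∩ ball b r := by
  rw [mem_inter_iff, mem_ball, mem_ball, dist_midpoint_left, dist_midpoint_right, Real.norm_two]
  constructor <;> linarith

theorem isPreconnected_sphere_inter_sphere_of_finiteDimensional [FiniteDimensional ℝ X]
    (hdim : 3 ≤ Module.rank ℝ X) (h : dist a b < 2 * r) :
    IsPreconnected (sphere a r ∩ sphere b r) := by
  have : ProperSpace X := FiniteDimensional.proper_real X
  have : IsClosed ((ℝ ∙ (a - b) : Submodule ℝ X) : Set X) :=
    Submodule.closed_of_finiteDimensional _
  have hr : r ≠ 0 := by linarith [dist_nonneg (x := a) (y := b)]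
  rw [← shadowBoundary_closedBall_inter_closedBall hr]
  have hdim_gt : (1 + 1 : Cardinal) < Module.rank ℝ X := lt_of_lt_of_le (by norm_num) hdim
  refine isPreconnected_shadowBoundary (lt_rank_quotient_span_singleton hdim_gt _)
    (Submodule.isOpenQuotientMap_mkQ _)
    ((isCompact_closedBall a r).inter (isCompact_closedBall b r))
    ((convex_closedBall a r).inter (convex_closedBall b r)) ?_
  rw [interior_closedBall_inter_closedBall hr]
  exact ⟨_, midpoint_mem_ball_inter_ball h⟩

theorem isPreconnected_sphere_inter_sphere (hdim : 3 ≤ Module.rank ℝ X) (h : dist a b < 2 * r) :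
    IsPreconnected (sphere a r ∩ sphere b r) := by
  refine isPreconnected_of_forall_pair fun x hx y hy => ?_
  obtain ⟨W, hfin, hsub, hW⟩ :=
    exists_finiteDimensional_superset_le_rank (n := 3) hdim (toFinite {a, b, x, y})
  simp only [insert_subset_iff, singleton_subset_iff, SetLike.mem_coe] at hsub
  obtain ⟨ha, hb, hxW, hyW⟩ := hsub
  lift a to W using ha
  lift b to W using hb
  lift x to W using hxW
  lift y to W using hyW
  refine ⟨Subtype.val '' (sphere a r ∩ sphere b r), ?_, ⟨x, hx, rfl⟩, ⟨y, hy, rfl⟩,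
    (isPreconnected_sphere_inter_sphere_of_finiteDimensional hW h).image _
      continuous_subtype_val.continuousOn⟩
  rintro _ ⟨z, hz, rfl⟩
  exact hz

theorem exists_mem_sphere_inter_sphere_dist_eq (hdim : 3 ≤ Module.rank ℝ X) {c : X} {q : ℝ}
    (hc : c ∈ sphere a r ∩ sphere b r) (hq : 0 < q) (hqr : q ≤ 2 * r - dist a b) :
    ∃ d ∈ sphere a r ∩ sphere b r, dist d c = q := by
  simp only [mem_inter_iff, mem_sphere_iff_norm] at hc
  have hreflection : a + b - c ∈ sphere a r ∩ sphere b r := by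
    simp only [mem_inter_iff, mem_sphere_iff_norm]
    constructor
    · rw [← hc.2, ← norm_neg]
      congr 1
      abel
    · rw [← hc.1, ← norm_neg]
      congr 1
      abel
  have hfar : q ≤ dist (a + b - c) c := by
    calc q ≤ 2 * r - dist a b := hqr
      _ = ‖(2 : ℝ) • (c - a)‖ - ‖b - a‖ := by
        rw [norm_smul, Real.norm_two, hc.1, dist_eq_norm_sub']
      _ ≤ ‖(2 : ℝ) • (c - a) - (b - a)‖ := norm_sub_norm_le _ _
      _ = dist (a + b - c) c := by
        rw [dist_eq_norm_sub']
        congr 1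
        module
  obtain ⟨d, hd, hdc⟩ := (isPreconnected_sphere_inter_sphere hdim
    (by linarith : dist a b < 2 * r)).intermediate_value (f := fun x => dist x c)
      (by simpa only [mem_inter_iff, mem_sphere_iff_norm] using hc) hreflection (by fun_prop)
      (show q ∈ Icc _ _ from ⟨by simpa using hq.le, hfar⟩)
  exact ⟨d, hd, hdc⟩

end SphereInterSphere

section Equilateral

variable {X : Type*} [NormedAddCommGroup X] {p : ℝ}

namespace IsEquilateralWith

theorem insert {S : Set X} (hS : IsEquilateralWith p S) {d : X} (hd : ∀ x ∈ S, ‖d - x‖ = p) :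
    IsEquilateralWith p (insert d S) := by
  refine ⟨hS.1, ?_⟩
  rintro x (rfl | hx) y (rfl | hy) hxy
  · exact absurd rfl hxy
  · exact hd y hy
  · rw [norm_sub_rev]
    exact hd x hx
  · exact hS.2 x hx y hy hxy

theorem exists_norm_sub_eq [NormedSpace ℝ X] (hdim : 3 ≤ Module.rank ℝ X) {a b c : X}
    (hab : a ≠ b) (hbc : b ≠ c) (hac : a ≠ c) (h : IsEquilateralWith p {a, b, c}) :
    ∃ d : X, ‖d - a‖ = p ∧ ‖d - b‖ = p ∧ ‖d - c‖ = p := by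
  obtain ⟨hp, hdist⟩ := h
  have dist_ab : dist a b = p := by
    rw [dist_eq_norm]
    exact hdist a (by simp) b (by simp) hab
  have hc : c ∈ sphere a p ∩ sphere b p := by
    simp only [mem_inter_iff, mem_sphere_iff_norm]
    exact ⟨hdist c (by simp) a (by simp) hac.symm, hdist c (by simp) b (by simp) hbc.symm⟩
  obtain ⟨d, ⟨hda, hdb⟩, hdc⟩ :=
    exists_mem_sphere_inter_sphere_dist_eq hdim hc hp (by linarith)
  exact ⟨d, mem_sphere_iff_norm.1 hda, mem_sphere_iff_norm.1 hdb, by rwa [← dist_eq_norm]⟩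

end IsEquilateralWith

end Equilateral

theorem theorem1_general {X : Type*} [NormedAddCommGroup X] [NormedSpace ℝ X]
    (hdim : 3 ≤ Module.rank ℝ X) :
    (∀ (p : ℝ) (a b c : X), a ≠ b → b ≠ c → a ≠ c →
        IsEquilateralWith p ({a, b, c} : Set X) →
        ∃ d : X, ‖d - a‖ = p ∧ ‖d - b‖ = p ∧ ‖d - c‖ = p) ∧
    (∀ S : Set X, IsEquilateral S → S.ncard = 3 →
        ∃ T : Set X, S ⊆ T ∧ T.ncard = 4 ∧ IsEquilateral T) := by
  refine ⟨fun p a b c hab hbc hac h => h.exists_norm_sub_eq hdim hab hbc hac, ?_⟩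
  rintro S ⟨p, hS⟩ hcard
  obtain ⟨a, b, c, hab, hac, hbc, rfl⟩ := ncard_eq_three.1 hcard
  obtain ⟨d, hda, hdb, hdc⟩ := hS.exists_norm_sub_eq hdim hab hbc hac
  have hd : ∀ x ∈ ({a, b, c} : Set X), ‖d - x‖ = p := by
    rintro x (rfl | rfl | rfl) <;> assumption
  have hd_notMem : d ∉ ({a, b, c} : Set X) := fun hmem => hS.1.ne (by simpa using hd d hmem)
  refine ⟨insert d {a, b, c}, subset_insert _ _, ?_, p, hS.insert hd⟩
  rw [ncard_insert_of_notMem hd_notMem (toFinite _), hcard]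

theorem theorem1 {X : Type*} [NormedAddCommGroup X] [NormedSpace ℝ X]
    (hdim : Module.finrank ℝ X = 3) :
    (∀ (p : ℝ) (a b c : X), a ≠ b → b ≠ c → a ≠ c →
        IsEquilateralWith p ({a, b, c} : Set X) →
        ∃ d : X, ‖d - a‖ = p ∧ ‖d - b‖ = p ∧ ‖d - c‖ = p) ∧
    (∀ S : Set X, IsEquilateral S → S.ncard = 3 →
        ∃ T : Set X, S ⊆ T ∧ T.ncard = 4 ∧ IsEquilateral T) := by
  have : FiniteDimensional ℝ X := .of_finrank_pos (by omega)
  exact theorem1_general (by rw [← finrank_eq_rank, hdim, Nat.cast_ofNat])
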